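/- Let $\Gamma$ be a closed rectifiable curve in the Euclidean plane, with a parametrization (self-intersections are allowed), and let $v_1,\dots,v_N$, $N\ge 2$, be points on $\Gamma$, not necessarily distinct, listed in the order of the parametrization, with $v_{N+1}=v_1$. Let $e_i$ be the part of $\Gamma$ from $v_i$ to $v_{i+1}$, let $f_i$ be the directed segment (chord) from $v_i$ to $v_{i+1}$, and let $\ell_i=|v_{i+1}-v_i|$. Let $P$ be the region, counted with multiplicities, bounded by $\Gamma$, with signed area $\operatorname{area}(P)=\int_\Gamma x\,dy$. Let $x(e_i)=\int_{e_i}x\,dy-\int_{f_i}x\,dy$ be the signed area bounded by $e_i$ followed by the reversed chord, and set $X(P)=\sum_{i=1}^N x(e_i)$. Let $L(P)$ be the length of $\Gamma$, let $N(P)=N$, and let $\alpha(P)=\min(1,\operatorname{area}(P))$. For $c,x\ge0$ let $\operatorname{arc}(c,x)$ be the length of a circular arc which together with a chord of length $c$ joining its endpoints encloses the area $x$; in particular $\operatorname{arc}(c,0)=c$ and $\operatorname{arc}(0,x)=2\sqrt{\pi x}$. (a) Let $s$ and $\ell$ be real numbers with $\ell_i\le s$ for all $i$ and $s<\ell\le\sum_i\ell_i$.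 If $|X(P)|\le \pi s^2/8$, then $$L(P)\ \ge\ \frac{\ell}{s}\,\operatorname{arc}\!\left(s,\frac{s\,|X(P)|}{\ell}\right).$$ (b) For $N\ge3$ and $X\le\alpha$ let $L(N,\alpha,X)=2\sqrt{(\alpha-X)\,N\tan(\pi/N)}$, the perimeter of a regular $N$-gon of area $\alpha-X$, and (when $X<\alpha$) let $$L'(N,\alpha,X)=L(N,\alpha,X)\,\operatorname{arc}\!\left(1,\frac{|X|}{L(N,\alpha,X)}\right).$$ If $\ell_i\le1$ for all $i$, and if $N=N(P)$, $\alpha=\alpha(P)$, $X=X(P)$ satisfy $|X|\le0.119$, $0.996\le\alpha\le1$ and $N\le7$ (these conditions force $N\ge3$), then $$L(P)\ \ge\ L'(N,\alpha,X).$$ -/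

import Mathlib

open Set MeasureTheory

/-! ### Circular arcs -/

/-- `IsArcLength c x L`: `L` is the length of a circular arc which, together with the chord of
length `c` joining its endpoints, encloses the area `x`.  An arc of radius `ρ` and half-angle
`θ ∈ (0, π]` has chord `2 ρ sin θ`, length `2 ρ θ`, and cuts off the area
`ρ² (θ - sin θ cos θ)` (for `θ = π` it is a full circle, with chord `0`).  The degenerate arc is
the chord itself, enclosing area `0`. -/
def IsArcLength (c x L : ℝ) : Prop :=
  (x = 0 ∧ L = c) ∨
    ∃ ρ θ : ℝ, 0 < ρ ∧ 0 < θ ∧ θ ≤ Real.pi ∧ c = 2 * ρ * Real.sin θ ∧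
      x = ρ ^ 2 * (θ - Real.sin θ * Real.cos θ) ∧ L = 2 * ρ * θ

theorem segment_pos {θ : ℝ} (h0 : 0 < θ) : 0 < θ - Real.sin θ * Real.cos θ := by
  have h := Real.sin_lt (x := 2 * θ) (by linarith)
  rw [Real.sin_two_mul] at h
  linarith

theorem segment_ratio_lt {a b : ℝ} (ha : 0 < a) (hab : a < b) (hb : b ≤ Real.pi) :
    Real.sin b ^ 2 / (b - Real.sin b * Real.cos b) <
      Real.sin a ^ 2 / (a - Real.sin a * Real.cos a) := by
  have hanti : StrictAntiOn
      (fun t : ℝ => Real.sin t ^ 2 / (t - Real.sin t * Real.cos t)) (Icc a b) := by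
    apply strictAntiOn_of_deriv_neg (convex_Icc a b)
    · apply ContinuousOn.div (by fun_prop) (by fun_prop)
      intro t ht
      exact (segment_pos (lt_of_lt_of_le ha ht.1)).ne'
    · intro t ht
      rw [interior_Icc] at ht
      have ht0 : 0 < t := ha.trans ht.1
      have htpi : t < Real.pi := ht.2.trans_le hb
      have hp := segment_pos ht0
      have hs := Real.sin_pos_of_pos_of_lt_pi ht0 htpi
      have hd := ((Real.hasDerivAt_sin t).pow 2).div
        ((hasDerivAt_id t).sub ((Real.hasDerivAt_sin t).mul (Real.hasDerivAt_cos t))) hp.ne'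
      have hd' := hd.deriv
      have e : (fun t : ℝ => Real.sin t ^ 2 / (t - Real.sin t * Real.cos t)) =
          (Real.sin ^ 2) / (id - Real.sin * Real.cos) := by
        ext t; simp
      rw [e, hd']
      apply div_neg_of_neg_of_pos _ (pow_pos hp 2)
      have key : t * Real.cos t - Real.sin t < 0 := by
        rcases lt_or_ge t (Real.pi / 2) with h | h
        · have := Real.lt_tan ht0 h
          rw [Real.tan_eq_sin_div_cos, lt_div_iff₀ (Real.cos_pos_of_mem_Ioo ⟨by linarith, h⟩)]
            at this
          linarith
        · have := Real.cos_nonpos_of_pi_div_two_le_of_le h (by linarith)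
          nlinarith
      have hsc := Real.sin_sq_add_cos_sq t
      have : 2 * Real.sin t * (t * Real.cos t - Real.sin t) < 0 := by
        apply mul_neg_of_pos_of_neg (by linarith) key
      simp only [Pi.sub_apply, Pi.mul_apply, Pi.pow_apply, id_eq, Nat.cast_ofNat]
      have e2 : Real.cos t ^ 2 = 1 - Real.sin t ^ 2 := by linarith
      have e3 : Real.cos t * Real.cos t + Real.sin t * -Real.sin t = 1 - 2 * Real.sin t ^ 2 := by
        rw [← sq, e2]; ring
      rw [e3]
      calc _ = 2 * Real.sin t * (t * Real.cos t)
              - 2 * Real.sin t * Real.sin t * (Real.cos t ^ 2 + Real.sin t ^ 2) := by ring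
        _ = 2 * Real.sin t * (t * Real.cos t - Real.sin t) := by rw [e2]; ring
        _ < 0 := this
  exact hanti ⟨le_refl a, hab.le⟩ ⟨hab.le, le_refl b⟩ hab

theorem exists_halfAngle {y : ℝ} (hy : 0 ≤ y) :
    ∃ θ : ℝ, 0 < θ ∧ θ ≤ Real.pi ∧
      Real.sin θ ^ 2 = y * (θ - Real.sin θ * Real.cos θ) := by
  set δ : ℝ := 1 / (2 * (y + 1)) with hδ
  have hδ0 : 0 < δ := by positivity
  have hδ1 : δ ≤ 1 / 2 := by
    rw [hδ, div_le_div_iff₀ (by positivity) (by norm_num)]; linarith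
  have hyδ : y * δ ≤ 1 / 2 := by
    rw [hδ, mul_one_div, div_le_div_iff₀ (by positivity) (by norm_num)]; linarith
  have hpi := Real.pi_gt_three
  have hpos : 0 ≤ Real.sin δ ^ 2 - y * (δ - Real.sin δ * Real.cos δ) := by
    have h1 := Real.sin_gt_sub_cube hδ0
    have h2 := Real.sin_gt_sub_cube (x := 2 * δ) (by linarith)
    rw [Real.sin_two_mul] at h2
    have h3 : δ - Real.sin δ * Real.cos δ ≤ δ ^ 3 := by nlinarith [pow_pos hδ0 3]
    have h4 : 3 / 4 * δ ≤ Real.sin δ := by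
      have : δ ^ 2 ≤ (1 / 2) ^ 2 := pow_le_pow_left₀ hδ0.le hδ1 2
      nlinarith
    have h5 : (3 / 4 * δ) ^ 2 ≤ Real.sin δ ^ 2 := pow_le_pow_left₀ (by positivity) h4 2
    have h6 : y * (δ - Real.sin δ * Real.cos δ) ≤ y * δ ^ 3 := mul_le_mul_of_nonneg_left h3 hy
    have h7 : y * δ ^ 3 ≤ 1 / 2 * δ ^ 2 := by
      calc y * δ ^ 3 = (y * δ) * δ ^ 2 := by ring
        _ ≤ _ := mul_le_mul_of_nonneg_right hyδ (by positivity)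
    nlinarith
  have hcont : ContinuousOn
      (fun t : ℝ => Real.sin t ^ 2 - y * (t - Real.sin t * Real.cos t)) (Icc δ Real.pi) := by
    fun_prop
  obtain ⟨θ, hθ, hθ0⟩ := intermediate_value_Icc' (by linarith : δ ≤ Real.pi) hcont
    (show (0 : ℝ) ∈ Icc _ _ from ⟨by simp; positivity, hpos⟩)
  exact ⟨θ, hδ0.trans_le hθ.1, hθ.2, by simpa [sub_eq_zero] using hθ0⟩

/-- For every chord length `c ≥ 0` and area `x ≥ 0` there is exactly one arc length. -/
theorem existsUnique_isArcLength {c x : ℝ} (hc : 0 ≤ c) (hx : 0 ≤ x) :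
    ∃! L, IsArcLength c x L := by
  rcases hx.eq_or_lt with rfl | hx
  · refine ⟨c, Or.inl ⟨rfl, rfl⟩, ?_⟩
    rintro L (⟨-, h⟩ | ⟨ρ, θ, hρ, hθ, -, -, h, -⟩)
    · exact h
    · exact absurd h (mul_pos (pow_pos hρ 2) (segment_pos hθ)).ne
  · obtain ⟨θ, hθ, hθpi, hy⟩ := exists_halfAngle (y := c ^ 2 / (4 * x)) (by positivity)
    have hp := segment_pos hθ
    have hsin : 0 ≤ Real.sin θ := Real.sin_nonneg_of_nonneg_of_le_pi hθ.le hθpi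
    set p := θ - Real.sin θ * Real.cos θ with hpdef
    have hρ : 0 < Real.sqrt (x / p) := Real.sqrt_pos.2 (by positivity)
    have hρ2 : Real.sqrt (x / p) ^ 2 = x / p := Real.sq_sqrt (by positivity)
    refine ⟨2 * Real.sqrt (x / p) * θ,
      Or.inr ⟨Real.sqrt (x / p), θ, hρ, hθ, hθpi, ?_, ?_, rfl⟩, ?_⟩
    · have : c ^ 2 = (2 * Real.sqrt (x / p) * Real.sin θ) ^ 2 := by
        rw [mul_pow, mul_pow, hρ2, hy]; field_simp; norm_num
      exact (pow_left_inj₀ hc (by positivity) two_ne_zero).1 this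
    · rw [hρ2, div_mul_cancel₀ _ hp.ne']
    · rintro L (⟨h, -⟩ | ⟨ρ', θ', hρ', hθ', hθpi', hc', hx', rfl⟩)
      · exact absurd h hx.ne'
      · have hp' := segment_pos hθ'
        have r' : Real.sin θ' ^ 2 / (θ' - Real.sin θ' * Real.cos θ') = c ^ 2 / (4 * x) := by
          rw [hx', hc']
          have := hp'.ne'
          have := hρ'.ne'
          field_simp
          norm_num
        have r : Real.sin θ ^ 2 / p = c ^ 2 / (4 * x) := by
          rw [hy, mul_div_cancel_right₀ _ hp.ne']
        have hEq : θ' = θ := by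
          rcases lt_trichotomy θ' θ with h | h | h
          · have := segment_ratio_lt hθ' h hθpi
            rw [r', ← hpdef, r] at this
            exact absurd this (lt_irrefl _)
          · exact h
          · have := segment_ratio_lt hθ h hθpi'
            rw [r', ← hpdef, r] at this
            exact absurd this (lt_irrefl _)
        subst hEq
        have : Real.sqrt (x / p) = ρ' := by
          rw [hx', ← hpdef, mul_div_cancel_right₀ _ hp.ne', Real.sqrt_sq hρ'.le]
        rw [this]

/-- `arc c x`, for `c, x ≥ 0`: the length of a circular arc that encloses the area `x` together
with a chord of length `c`. -/
noncomputable def arc (c x : ℝ) : ℝ := Classical.epsilon (IsArcLength c x)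

theorem isArcLength_arc {c x : ℝ} (hc : 0 ≤ c) (hx : 0 ≤ x) : IsArcLength c x (arc c x) :=
  Classical.epsilon_spec (existsUnique_isArcLength hc hx).exists

/-! ### Closed rectifiable curves with marked points -/

/-- A closed rectifiable curve in the Euclidean plane with `N ≥ 2` marked points
`v₀, …, v_{N-1}` (not necessarily distinct), listed in the order given by the parametrization.
The parametrization starts and ends at `v₀`; the point `vᵢ` has parameter `τ i`, and `τ N` is the
parameter of the return to `v₀`. -/
structure MarkedCurve (N : ℕ) where
  two_le : 2 ≤ N
  γ : ℝ → EuclideanSpace ℝ (Fin 2)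
  τ : Fin (N + 1) → ℝ
  mono : Monotone τ
  continuousOn : ContinuousOn γ (Icc (τ 0) (τ (Fin.last N)))
  rectifiable : BoundedVariationOn γ (Icc (τ 0) (τ (Fin.last N)))
  closed : γ (τ (Fin.last N)) = γ (τ 0)

namespace MarkedCurve

variable {N : ℕ} (P : MarkedCurve N)

/-- The second coordinate `y` along the curve, extended to all parameters by its values at the two
ends of the parameter interval. -/
noncomputable def yExt (t : ℝ) : ℝ :=
  P.γ (projIcc (P.τ 0) (P.τ (Fin.last N)) (P.mono (Fin.zero_le _)) t) 1

theorem boundedVariationOn_yExt : BoundedVariationOn P.yExt univ := by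
  have hl : LipschitzWith 1 (fun v : EuclideanSpace ℝ (Fin 2) => v 1) := by
    apply LipschitzWith.of_dist_le_mul
    intro v w
    rw [NNReal.coe_one, one_mul, dist_eq_norm, dist_eq_norm]
    simpa using PiLp.norm_apply_le (v - w) 1
  have h1 : BoundedVariationOn
      (P.γ ∘ fun t => (projIcc (P.τ 0) (P.τ (Fin.last N)) (P.mono (Fin.zero_le _)) t : ℝ))
      univ := by
    refine ne_top_of_le_ne_top P.rectifiable (eVariationOn.comp_le_of_monotoneOn _ _ ?_ ?_)
    · intro a _ b _ hab
      exact monotone_projIcc _ hab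
    · intro t _
      exact (projIcc _ _ _ t).2
  exact hl.comp_boundedVariationOn h1

/-- The Lebesgue-Stieltjes integral `∫ x dy` along the part of the curve with parameters between
`a` and `b`. -/
noncomputable def lineIntegral (a b : ℝ) : ℝ :=
  VectorMeasure.integral (P.boundedVariationOn_yExt.vectorMeasure.restrict (Ioc a b))
    (fun t => P.γ t 0) (ContinuousLinearMap.lsmul ℝ ℝ)

/-- The length of the curve. -/
noncomputable def length : ℝ :=
  (eVariationOn P.γ (Icc (P.τ 0) (P.τ (Fin.last N)))).toReal

/-- The signed area of the curve, by Green's formula. This is the signed area of the integral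
current (regions counted with multiplicities) bounded by the curve. -/
noncomputable def area : ℝ := P.lineIntegral (P.τ 0) (P.τ (Fin.last N))

/-- The initial point of the `i`-th edge and of the `i`-th chord. -/
def src (i : Fin N) : EuclideanSpace ℝ (Fin 2) := P.γ (P.τ i.castSucc)

/-- The final point of the `i`-th edge and of the `i`-th chord. -/
def tgt (i : Fin N) : EuclideanSpace ℝ (Fin 2) := P.γ (P.τ i.succ)

/-- The length of the `i`-th chord. -/
noncomputable def chordLength (i : Fin N) : ℝ := dist (P.src i) (P.tgt i)

/-- The signed area `x(eᵢ)` bounded by the `i`-th edge followed by the reversed `i`-th chord: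
`∫ x dy` along the edge minus `∫ x dy` along the chord, a line segment. -/
noncomputable def edgeArea (i : Fin N) : ℝ :=
  P.lineIntegral (P.τ i.castSucc) (P.τ i.succ) -
    (P.src i 0 + P.tgt i 0) / 2 * (P.tgt i 1 - P.src i 1)

/-- `X(P)`, the sum of the signed areas `x(eᵢ)`. -/
noncomputable def X : ℝ := ∑ i, P.edgeArea i

/-- `α(P) = min (1, area P)`. -/
noncomputable def alpha : ℝ := min 1 P.area

end MarkedCurve

/-- The isoperimetric constant `π_N = N tan (π / N)` of the regular `N`-gon, `N ≥ 3`. -/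
noncomputable def piN (N : ℕ) : ℝ := N * Real.tan (Real.pi / N)

/-- `L(N, α, X)`, the perimeter of the regular `N`-gon of area `α - X`, for `N ≥ 3`, `X ≤ α`. -/
noncomputable def polygonBound (N : ℕ) (α X : ℝ) : ℝ := 2 * Real.sqrt ((α - X) * piN N)

/-- `L'(N, α, X) = L(N, α, X) arc(1, |X| / L(N, α, X))`. -/
noncomputable def arcBound (N : ℕ) (α X : ℝ) : ℝ :=
  polygonBound N α X * arc 1 (|X| / polygonBound N α X)

/-!
The proof rests on one inequality for triangles: if `φ, ψ > 0` and `φ + ψ < π`, then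
`cot (φ + ψ) |u + v|² + 2 (u × v) ≤ cot φ |u|² + cot ψ |v|²`, the difference being a square
(`cot_add_mul_le`). Induction over the edges gives, for a polygon whose edges `e j` carry angles
`φ j` of sum `θ < π`, with chord `c` and signed area `A` between polygon and chord,
`4 A + c² cot θ ≤ ∑ j, |e j|² cot (φ j)`; the same holds without the chord term for a closed polygon
with angles of sum `π`. Both isoperimetric inequalities needed here follow by taking angles
proportional to the edge lengths.

* For open polygons, `cot t ≤ 1 / t` gives `4 A ≤ L² / θ - c² cot θ` for every `θ ∈ (0, π)`, which is
  Dido's inequality. It passes to rectifiable curves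
  (`MarkedCurve.four_mul_abs_lineIntegral_sub_chord_le`) because the Stieltjes integral `∫ x dy` is a
  limit of trapezoidal sums, that is of areas of inscribed polygons.
* For closed `N`-gons, Jensen's inequality for the concave function `t² cot t` gives
  `4 A N tan (π / N) ≤ L²` (`trapezoid_le_of_closed`).

For the chordal inequality, let `ρ` and `θ` be the radius and half-angle of the comparison arc over
the chord `s`; the bound on `|X|` makes `θ ≤ π / 2`. Dido's inequality implies that an edge of
length `L` over the chord `2 ρ sin φ` that encloses an area at least `t`, with `t` at most that of a
half-disc of radius `ρ`, satisfies `L ≥ ρ (φ + sin φ cos φ) + t / ρ` (`add_div_le_of_dido`), with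
equality for the comparison arc. As a function of the chord the first term divided by the chord is
decreasing, so it is at least the chord divided by `s` times its value for the chord `s`. The areas
`|x i|` are scaled down to shares `t` of sum `|X|`, which keeps them in the admissible range, and
summation gives the claim.

The bound for at most seven edges is the case `s = 1`, `ℓ = L(N, α, X)`: the polygon of chords has
signed area `area P - X ≥ α - X`, so its perimeter is at least `ℓ` by the inequality for `N`-gons.
-/

/-! ### Polygons with weighted edges -/

/-- The case of a triangle, with sides `u = (a, b)`, `v = (c, d)` and `u + v`. After multiplication
by `sin φ sin ψ sin (φ + ψ)` the difference of the two sides is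
`|sin ψ • u - sin φ • R v| ^ 2`, where `R` is the rotation by `-(φ + ψ)`. -/
theorem cot_add_mul_le {φ ψ : ℝ} (hφ : 0 < φ) (hψ : 0 < ψ) (h : φ + ψ < Real.pi) (a b c d : ℝ) :
    Real.cot (φ + ψ) * ((a + c) ^ 2 + (b + d) ^ 2) + 2 * (a * d - b * c) ≤
      Real.cot φ * (a ^ 2 + b ^ 2) + Real.cot ψ * (c ^ 2 + d ^ 2) := by
  have s1 := Real.sin_pos_of_pos_of_lt_pi hφ (by linarith)
  have s2 := Real.sin_pos_of_pos_of_lt_pi hψ (by linarith)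
  have s3 := Real.sin_pos_of_pos_of_lt_pi (add_pos hφ hψ) h
  rw [← sub_nonneg]
  have key : Real.cot φ * (a ^ 2 + b ^ 2) + Real.cot ψ * (c ^ 2 + d ^ 2) -
      (Real.cot (φ + ψ) * ((a + c) ^ 2 + (b + d) ^ 2) + 2 * (a * d - b * c)) =
      ((Real.sin ψ * a - Real.sin φ * (Real.cos (φ + ψ) * c + Real.sin (φ + ψ) * d)) ^ 2 +
        (Real.sin ψ * b - Real.sin φ * (Real.cos (φ + ψ) * d - Real.sin (φ + ψ) * c)) ^ 2) /
        (Real.sin φ * Real.sin ψ * Real.sin (φ + ψ)) := by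
    simp only [Real.cot_eq_cos_div_sin]
    field_simp
    rw [Real.sin_add, Real.cos_add]
    have e1 : Real.cos φ ^ 2 = 1 - Real.sin φ ^ 2 := by linarith [Real.sin_sq_add_cos_sq φ]
    have e2 : Real.cos ψ ^ 2 = 1 - Real.sin ψ ^ 2 := by linarith [Real.sin_sq_add_cos_sq ψ]
    grind
  rw [key]
  positivity

/-- An open polygon whose edges carry angles of sum `Φ < π`. Each edge contributes its squared
length times the cotangent of its angle; this dominates four times the area between the polygon and
its chord, plus `cot Φ` times the squared chord. Equality holds for polygons inscribed in a circular
arc whose edges subtend the inscribed angles `φ j`. -/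
theorem cot_sum_mul_add_le (x y φ : ℕ → ℝ) (hφ : ∀ j, 0 ≤ φ j)
    (h0 : ∀ j, φ j = 0 → x (j + 1) = x j ∧ y (j + 1) = y j) (n : ℕ)
    (hn : ∑ j ∈ Finset.range n, φ j < Real.pi) :
    Real.cot (∑ j ∈ Finset.range n, φ j) * ((x n - x 0) ^ 2 + (y n - y 0) ^ 2) +
      2 * ∑ j ∈ Finset.range n,
        ((x j - x 0) * (y (j + 1) - y j) - (y j - y 0) * (x (j + 1) - x j)) ≤
      ∑ j ∈ Finset.range n,
        Real.cot (φ j) * ((x (j + 1) - x j) ^ 2 + (y (j + 1) - y j) ^ 2) := by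
  have hz : ∀ n, ∑ j ∈ Finset.range n, φ j = 0 → x n = x 0 ∧ y n = y 0 := by
    intro n
    induction n with
    | zero => simp
    | succ n ih =>
      intro h
      rw [Finset.sum_range_succ] at h
      have h1 := Finset.sum_nonneg (s := Finset.range n) fun j _ => hφ j
      have h2 := hφ n
      have h3 := ih (by linarith)
      have h4 := h0 n (by linarith)
      exact ⟨h4.1.trans h3.1, h4.2.trans h3.2⟩
  induction n with
  | zero => simp
  | succ n ih =>
    rw [Finset.sum_range_succ] at hn
    have h2 := hφ n
    have ih := ih (by linarith)
    simp only [Finset.sum_range_succ]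
    rcases h2.eq_or_lt with h | h
    · obtain ⟨hx, hy⟩ := h0 n h.symm
      rw [hx, hy, ← h]
      simpa using ih
    have h1 := Finset.sum_nonneg (s := Finset.range n) fun j _ => hφ j
    rcases h1.eq_or_lt with h' | h'
    · obtain ⟨hx, hy⟩ := hz n h'.symm
      rw [hx, hy, ← h'] at ih ⊢
      simp only [sub_self, zero_mul, zero_add, add_zero, zero_pow two_ne_zero, mul_zero] at ih ⊢
      linarith
    · have := cot_add_mul_le h' h hn (x n - x 0) (y n - y 0) (x (n + 1) - x n) (y (n + 1) - y n)
      rw [show x n - x 0 + (x (n + 1) - x n) = x (n + 1) - x 0 by ring,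
        show y n - y 0 + (y (n + 1) - y n) = y (n + 1) - y 0 by ring] at this
      linarith

/-- A closed polygon whose edges carry angles of sum `π`: the last edge with a nonzero angle `φ` is
the chord of the open polygon formed by the preceding edges, and `cot (π - φ) = -cot φ`. -/
theorem two_mul_cross_sum_le (x y φ : ℕ → ℝ) (hφ : ∀ j, 0 ≤ φ j)
    (h0 : ∀ j, φ j = 0 → x (j + 1) = x j ∧ y (j + 1) = y j) (n : ℕ)
    (hn : ∑ j ∈ Finset.range n, φ j = Real.pi) (hlt : ∀ j < n, φ j < Real.pi)
    (hx : x n = x 0) (hy : y n = y 0) :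
    2 * ∑ j ∈ Finset.range n,
        ((x j - x 0) * (y (j + 1) - y j) - (y j - y 0) * (x (j + 1) - x j)) ≤
      ∑ j ∈ Finset.range n,
        Real.cot (φ j) * ((x (j + 1) - x j) ^ 2 + (y (j + 1) - y j) ^ 2) := by
  induction n with
  | zero => simp
  | succ n ih =>
    rw [Finset.sum_range_succ] at hn
    simp only [Finset.sum_range_succ]
    rcases (hφ n).eq_or_lt with h | h
    · obtain ⟨hx', hy'⟩ := h0 n h.symm
      rw [hx', hy', ← h]
      simpa using ih (by linarith) (fun j hj => hlt j (by omega)) (hx'.symm.trans hx)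
        (hy'.symm.trans hy)
    · have h1 := cot_sum_mul_add_le x y φ hφ h0 n (by linarith)
      rw [show ∑ j ∈ Finset.range n, φ j = Real.pi - φ n by linarith] at h1
      have e : Real.cot (Real.pi - φ n) = -Real.cot (φ n) := by
        rw [Real.cot_eq_cos_div_sin, Real.cot_eq_cos_div_sin, Real.cos_pi_sub, Real.sin_pi_sub,
          neg_div]
      rw [e] at h1
      rw [hx, hy]
      linarith

theorem two_mul_trapezoid_sub_chord (x y : ℕ → ℝ) (n : ℕ) :
    2 * (∑ j ∈ Finset.range n, (x j + x (j + 1)) / 2 * (y (j + 1) - y j) -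
      (x 0 + x n) / 2 * (y n - y 0)) =
    ∑ j ∈ Finset.range n,
        ((x j - x 0) * (y (j + 1) - y j) - (y j - y 0) * (x (j + 1) - x j)) := by
  induction n with
  | zero => simp
  | succ n ih => rw [Finset.sum_range_succ, Finset.sum_range_succ, ← ih]; ring

/-! ### Isoperimetric inequalities for polygons -/

theorem cot_le_inv {φ : ℝ} (h0 : 0 < φ) (hpi : φ < Real.pi) : Real.cot φ ≤ φ⁻¹ := by
  have hs := Real.sin_pos_of_pos_of_lt_pi h0 hpi
  rw [Real.cot_eq_cos_div_sin, div_le_iff₀ hs, inv_mul_eq_div, le_div_iff₀ h0]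
  rcases lt_or_ge φ (Real.pi / 2) with h | h
  · have := Real.lt_tan h0 h
    rw [Real.tan_eq_sin_div_cos, lt_div_iff₀ (Real.cos_pos_of_mem_Ioo ⟨by linarith, h⟩)] at this
    linarith
  · have := Real.cos_nonpos_of_pi_div_two_le_of_le h (by linarith)
    nlinarith

/-- Dido's inequality for a polygon, in linearised form: one inequality for each angle `θ`.
The angle `θ` is distributed over the edges in proportion to their lengths, and `cot φ ≤ φ⁻¹`. -/
theorem four_mul_trapezoid_sub_chord_le (x y l : ℕ → ℝ) (n : ℕ) {θ : ℝ} (hθ : 0 < θ)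
    (hpi : θ < Real.pi) (hl : ∀ j, 0 ≤ l j)
    (hl2 : ∀ j, l j ^ 2 = (x (j + 1) - x j) ^ 2 + (y (j + 1) - y j) ^ 2) :
    4 * (∑ j ∈ Finset.range n, (x j + x (j + 1)) / 2 * (y (j + 1) - y j) -
      (x 0 + x n) / 2 * (y n - y 0)) ≤
    (∑ j ∈ Finset.range n, l j) ^ 2 / θ -
      Real.cot θ * ((x n - x 0) ^ 2 + (y n - y 0) ^ 2) := by
  have e := two_mul_trapezoid_sub_chord x y n
  set L := ∑ j ∈ Finset.range n, l j with hL
  have hl0 : ∀ j, l j = 0 → x (j + 1) = x j ∧ y (j + 1) = y j := by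
    intro j hj
    have := hl2 j
    rw [hj] at this
    constructor <;> nlinarith [sq_nonneg (x (j + 1) - x j), sq_nonneg (y (j + 1) - y j)]
  have hL0 : 0 ≤ L := Finset.sum_nonneg fun j _ => hl j
  rcases hL0.eq_or_lt with h | h
  · have hj : ∀ j ∈ Finset.range n, l j = 0 :=
      (Finset.sum_eq_zero_iff_of_nonneg fun j _ => hl j).1 (hL.symm.trans h.symm)
    have hc : ∀ k ≤ n, x k = x 0 ∧ y k = y 0 := by
      intro k
      induction k with
      | zero => simp
      | succ k ih =>
        intro hk
        have h1 := ih (by omega)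
        have h2 := hl0 k (hj k (Finset.mem_range.2 (by omega)))
        exact ⟨h2.1.trans h1.1, h2.2.trans h1.2⟩
    have h3 : ∑ j ∈ Finset.range n,
        ((x j - x 0) * (y (j + 1) - y j) - (y j - y 0) * (x (j + 1) - x j)) = 0 := by
      apply Finset.sum_eq_zero
      intro j hj
      obtain ⟨h1, h2⟩ := hc j (Finset.mem_range.1 hj).le
      rw [h1, h2]; ring
    obtain ⟨h1, h2⟩ := hc n le_rfl
    rw [h3, h1, h2] at e
    rw [h1, h2, ← h]
    simp at e ⊢
    linarith
  · have hsum : ∑ j ∈ Finset.range n, θ * l j / L = θ := by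
      rw [← Finset.sum_div, ← Finset.mul_sum, ← hL]; field_simp
    have hφ : ∀ j, 0 ≤ θ * l j / L := fun j => by have := hl j; positivity
    have h1 := cot_sum_mul_add_le x y (fun j => θ * l j / L) hφ (by
      intro j hj
      apply hl0
      simpa [hθ.ne', h.ne'] using hj) n (by simpa only [hsum] using hpi)
    rw [hsum, ← e] at h1
    have h2 : ∑ j ∈ Finset.range n, Real.cot (θ * l j / L) *
        ((x (j + 1) - x j) ^ 2 + (y (j + 1) - y j) ^ 2) ≤ L ^ 2 / θ := by
      calc _ ≤ ∑ j ∈ Finset.range n, L / θ * l j := by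
            apply Finset.sum_le_sum
            intro j hj
            rw [← hl2]
            rcases (hl j).eq_or_lt with h' | h'
            · rw [← h']; simp
            have hle : l j ≤ L := Finset.single_le_sum (fun i _ => hl i) hj
            have : θ * l j / L ≤ θ := by
              rw [div_le_iff₀ h]; gcongr
            calc _ ≤ (θ * l j / L)⁻¹ * l j ^ 2 :=
                  mul_le_mul_of_nonneg_right (cot_le_inv (by positivity) (by linarith))
                    (sq_nonneg _)
              _ = _ := by field_simp
        _ = L ^ 2 / θ := by rw [← Finset.mul_sum, ← hL]; ring
    linarith

theorem abs_four_mul_trapezoid_sub_chord_le (x y l : ℕ → ℝ) (n : ℕ) {θ : ℝ} (hθ : 0 < θ)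
    (hpi : θ < Real.pi) (hl : ∀ j, 0 ≤ l j)
    (hl2 : ∀ j, l j ^ 2 = (x (j + 1) - x j) ^ 2 + (y (j + 1) - y j) ^ 2) :
    4 * |∑ j ∈ Finset.range n, (x j + x (j + 1)) / 2 * (y (j + 1) - y j) -
      (x 0 + x n) / 2 * (y n - y 0)| ≤
    (∑ j ∈ Finset.range n, l j) ^ 2 / θ -
      Real.cot θ * ((x n - x 0) ^ 2 + (y n - y 0) ^ 2) := by
  have h1 := four_mul_trapezoid_sub_chord_le x y l n hθ hpi hl hl2
  have h2 := four_mul_trapezoid_sub_chord_le x (-y) l n hθ hpi hl (fun j => by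
    rw [hl2]; simp only [Pi.neg_apply]; ring)
  have e : ∀ j, (x j + x (j + 1)) / 2 * (-y (j + 1) - -y j) =
    -((x j + x (j + 1)) / 2 * (y (j + 1) - y j)) := fun j => by ring
  simp only [Pi.neg_apply, e, Finset.sum_neg_distrib] at h2
  rw [show (-y n - -y 0) ^ 2 = (y n - y 0) ^ 2 by ring] at h2
  rcases abs_cases (∑ j ∈ Finset.range n, (x j + x (j + 1)) / 2 * (y (j + 1) - y j) -
      (x 0 + x n) / 2 * (y n - y 0)) with ⟨h, -⟩ | ⟨h, -⟩ <;> rw [h] <;> linarith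

/-- Concavity of `t ^ 2 * cot t`, extended by its limit `0` at `t = 0`, where `cot 0 = 0` in
Mathlib. -/
theorem concaveOn_sq_mul_cot :
    ConcaveOn ℝ (Ico 0 Real.pi) (fun t : ℝ => t ^ 2 * Real.cot t) := by
  have hs : ∀ t ∈ Ioo (0 : ℝ) Real.pi, 0 < Real.sin t := fun t ht =>
    Real.sin_pos_of_pos_of_lt_pi ht.1 ht.2
  have hint : interior (Ico (0 : ℝ) Real.pi) = Ioo 0 Real.pi := interior_Ico
  refine concaveOn_of_hasDerivWithinAt2_nonpos
    (f' := fun t => 2 * t * (Real.cos t / Real.sin t) - t ^ 2 / Real.sin t ^ 2)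
    (f'' := fun t => 2 / Real.sin t ^ 3 *
      (Real.cos t * (Real.sin t ^ 2 + t ^ 2) - 2 * t * Real.sin t))
    (convex_Ico _ _) ?_ ?_ ?_ ?_
  · have e : (fun t : ℝ => t ^ 2 * Real.cot t) = fun t => t * Real.cos t / Real.sinc t := by
      ext t
      rcases eq_or_ne t 0 with rfl | ht
      · simp
      · rw [Real.sinc_of_ne_zero ht, Real.cot_eq_cos_div_sin]
        field_simp
    rw [e]
    apply ContinuousOn.div (by fun_prop) Real.continuous_sinc.continuousOn
    intro t ht
    rcases ht.1.eq_or_lt with rfl | h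
    · simp
    · rw [Real.sinc_of_ne_zero h.ne']
      exact div_ne_zero (hs t ⟨h, ht.2⟩).ne' h.ne'
  · rw [hint]
    intro t ht
    have h := (hs t ht).ne'
    simp only [Real.cot_eq_cos_div_sin]
    have := ((hasDerivAt_pow 2 t).mul ((Real.hasDerivAt_cos t).div (Real.hasDerivAt_sin t) h))
    refine (this.congr_deriv ?_).hasDerivWithinAt
    have e2 : Real.cos t ^ 2 = 1 - Real.sin t ^ 2 := by linarith [Real.sin_sq_add_cos_sq t]
    simp only [Pi.div_apply]
    field_simp
    grind
  · rw [hint]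
    intro t ht
    have h := (hs t ht).ne'
    have := (((hasDerivAt_id t).const_mul 2).mul
      ((Real.hasDerivAt_cos t).div (Real.hasDerivAt_sin t) h)).sub
      ((hasDerivAt_pow 2 t).div ((Real.hasDerivAt_sin t).pow 2) (pow_ne_zero 2 h))
    refine (this.congr_deriv ?_).hasDerivWithinAt
    have e2 : Real.cos t ^ 2 = 1 - Real.sin t ^ 2 := by linarith [Real.sin_sq_add_cos_sq t]
    simp only [Pi.div_apply, Pi.pow_apply, id]
    field_simp
    grind
  · rw [hint]
    intro t ht
    have h := hs t ht
    have ht0 := ht.1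
    apply mul_nonpos_of_nonneg_of_nonpos (by positivity)
    rcases le_or_gt (Real.cos t) 0 with hc | hc
    · nlinarith [mul_nonneg (neg_nonneg.2 hc) (add_nonneg (sq_nonneg (Real.sin t)) (sq_nonneg t)),
        mul_pos ht0 h]
    · have h2 : t < Real.pi / 2 := by
        by_contra! h2
        linarith [Real.cos_nonpos_of_pi_div_two_le_of_le h2 (by linarith [ht.2])]
      have h3 := Real.lt_tan ht0 h2
      rw [Real.tan_eq_sin_div_cos, lt_div_iff₀ hc] at h3
      have h4 := Real.sin_lt ht0
      have h5 := Real.cos_le_one t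
      have : t ^ 2 * Real.cos t ≤ t * Real.sin t := by nlinarith
      have h7 : Real.cos t * Real.sin t ^ 2 ≤ t * Real.sin t := by
        have : Real.cos t * Real.sin t ≤ t := by nlinarith
        nlinarith
      linarith

/-- The isoperimetric inequality for closed polygons with `n` vertices, self-intersections allowed.
The angle `π` is distributed over the edges in proportion to their lengths; Jensen's inequality for
`t ^ 2 * cot t` then compares with the regular polygon. For `n = 2` the right-hand side vanishes. -/
theorem trapezoid_le_of_closed (x y l : ℕ → ℝ) (n : ℕ) (hl : ∀ j, 0 ≤ l j)
    (hl2 : ∀ j, l j ^ 2 = (x (j + 1) - x j) ^ 2 + (y (j + 1) - y j) ^ 2)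
    (hlt : ∀ j < n, 2 * l j ≤ ∑ j ∈ Finset.range n, l j)
    (hx : x n = x 0) (hy : y n = y 0) :
    4 * ∑ j ∈ Finset.range n, (x j + x (j + 1)) / 2 * (y (j + 1) - y j) ≤
    (∑ j ∈ Finset.range n, l j) ^ 2 * (Real.cot (Real.pi / n) / n) := by
  have e := two_mul_trapezoid_sub_chord x y n
  have hdido := four_mul_trapezoid_sub_chord_le x y l n (by positivity)
    (half_lt_self Real.pi_pos) hl hl2
  set L := ∑ j ∈ Finset.range n, l j with hL
  have hl0 : ∀ j, l j = 0 → x (j + 1) = x j ∧ y (j + 1) = y j := by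
    intro j hj
    have := hl2 j
    rw [hj] at this
    constructor <;> nlinarith [sq_nonneg (x (j + 1) - x j), sq_nonneg (y (j + 1) - y j)]
  have hL0 : 0 ≤ L := Finset.sum_nonneg fun j _ => hl j
  rcases hL0.eq_or_lt with h | h
  · rw [← h, hx, hy] at hdido
    rw [← h]
    simp at hdido ⊢
    linarith
  have hn : (0 : ℝ) < n := by
    rcases Nat.eq_zero_or_pos n with rfl | hn
    · simp [hL] at h
    · exact_mod_cast hn
  have hpi := Real.pi_pos
  have hsum : ∑ j ∈ Finset.range n, Real.pi * l j / L = Real.pi := by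
    rw [← Finset.sum_div, ← Finset.mul_sum, ← hL]; field_simp
  have hφ : ∀ j, 0 ≤ Real.pi * l j / L := fun j => by have := hl j; positivity
  have hφlt : ∀ j < n, Real.pi * l j / L < Real.pi := by
    intro j hj
    rw [div_lt_iff₀ h]
    have := hlt j hj
    gcongr
    linarith [hl j]
  have h1 := two_mul_cross_sum_le x y (fun j => Real.pi * l j / L) hφ (by
    intro j hj
    apply hl0
    simpa [hpi.ne', h.ne'] using hj) n hsum hφlt hx hy
  rw [← e, hy] at h1
  have h2 := concaveOn_sq_mul_cot.le_map_sum (t := Finset.range n) (w := fun _ => (n : ℝ)⁻¹)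
    (p := fun j => Real.pi * l j / L) (fun _ _ => by positivity) (by simp [hn.ne'])
    (fun j hj => ⟨hφ j, hφlt j (Finset.mem_range.1 hj)⟩)
  simp only [smul_eq_mul, ← Finset.mul_sum, hsum] at h2
  have h3 : ∑ j ∈ Finset.range n, Real.cot (Real.pi * l j / L) *
        ((x (j + 1) - x j) ^ 2 + (y (j + 1) - y j) ^ 2) =
      L ^ 2 / Real.pi ^ 2 *
        ∑ j ∈ Finset.range n, (Real.pi * l j / L) ^ 2 * Real.cot (Real.pi * l j / L) := by
    rw [Finset.mul_sum]
    apply Finset.sum_congr rfl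
    intro j _
    rw [← hl2]
    field_simp
  rw [h3] at h1
  have h4 : L ^ 2 / Real.pi ^ 2 *
        ∑ j ∈ Finset.range n, (Real.pi * l j / L) ^ 2 * Real.cot (Real.pi * l j / L) ≤
      L ^ 2 * (Real.cot (Real.pi / n) / n) := by
    rw [inv_mul_le_iff₀ hn] at h2
    calc _ ≤ L ^ 2 / Real.pi ^ 2 *
          (n * (((n : ℝ)⁻¹ * Real.pi) ^ 2 * Real.cot ((n : ℝ)⁻¹ * Real.pi))) := by gcongr
      _ = _ := by
        rw [inv_mul_eq_div]
        field_simp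
  linarith

/-! ### The dual bound and circular arcs -/

/-- The function `t + sin² φ cot t` on `(0, π - φ]` is smallest at `t = φ`. -/
theorem add_sin_mul_cos_le {φ t : ℝ} (hφ : 0 ≤ φ) (hφ2 : φ ≤ Real.pi / 2) (ht : 0 < t)
    (htφ : t ≤ Real.pi - φ) (htpi : t < Real.pi) :
    φ + Real.sin φ * Real.cos φ ≤ t + Real.sin φ ^ 2 * Real.cot t := by
  have hs := Real.sin_pos_of_pos_of_lt_pi ht htpi
  have hsφ := Real.sin_nonneg_of_nonneg_of_le_pi hφ (by linarith)
  have e : t + Real.sin φ ^ 2 * Real.cot t - (φ + Real.sin φ * Real.cos φ) =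
      ((t - φ) * Real.sin t - Real.sin φ * Real.sin (t - φ)) / Real.sin t := by
    rw [Real.cot_eq_cos_div_sin, Real.sin_sub]
    field_simp
    ring
  rw [← sub_nonneg, e]
  apply div_nonneg _ hs.le
  rcases le_total φ t with h | h
  · have h1 : Real.sin φ ≤ Real.sin t := by
      rcases le_total t (Real.pi / 2) with h' | h'
      · exact Real.sin_le_sin_of_le_of_le_pi_div_two (by linarith) h' h
      · rw [← Real.sin_pi_sub t]
        exact Real.sin_le_sin_of_le_of_le_pi_div_two (by linarith) (by linarith) (by linarith)
    have h2 := Real.sin_le (sub_nonneg.2 h)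
    nlinarith [mul_le_mul_of_nonneg_left h2 hsφ,
      mul_le_mul_of_nonneg_left h1 (sub_nonneg.2 h)]
  · obtain ⟨d, rfl⟩ : ∃ d, φ = t + d := ⟨φ - t, by ring⟩
    have hd : 0 ≤ d := by linarith
    have hcd : 0 ≤ Real.cos d := Real.cos_nonneg_of_mem_Icc ⟨by linarith, by linarith⟩
    have hsd : 0 ≤ Real.sin d := Real.sin_nonneg_of_nonneg_of_le_pi hd (by linarith)
    have hcφ : 0 ≤ Real.cos (t + d) := Real.cos_nonneg_of_mem_Icc ⟨by linarith, by linarith⟩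
    have h1 : d * Real.cos d ≤ Real.sin d := by
      rcases hd.eq_or_lt with rfl | hd'
      · simp
      · have h1 : d < Real.pi / 2 := by linarith
        have := Real.lt_tan hd' h1
        rw [Real.tan_eq_sin_div_cos, lt_div_iff₀ (Real.cos_pos_of_mem_Ioo ⟨by linarith, h1⟩)]
          at this
        exact this.le
    have h2 : Real.sin t ≤ Real.sin (t + d) * Real.cos d := by
      have : Real.sin t = Real.sin (t + d) * Real.cos d - Real.cos (t + d) * Real.sin d := by
        rw [← Real.sin_sub]; ring_nf
      nlinarith [mul_nonneg hcφ hsd]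
    rw [show t - (t + d) = -d by ring, Real.sin_neg]
    nlinarith [mul_le_mul_of_nonneg_left h1 hsφ, mul_le_mul_of_nonneg_left h2 hd]

/-- The bound dual to Dido's inequality. Among curves over a chord of length `2 ρ sin φ`, the minor
arc of radius `ρ` minimises the length minus `ρ⁻¹` times the area, as long as the area is at most
that of a half-disc of radius `ρ`. Without this restriction a large circle would violate it. -/
theorem add_div_le_of_dido {ρ φ t L : ℝ} (hρ : 0 < ρ) (hφ : 0 ≤ φ) (hφ2 : φ ≤ Real.pi / 2)
    (ht : t ≤ Real.pi * ρ ^ 2 / 2) (hL : 2 * ρ * Real.sin φ ≤ L)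
    (hdido : ∀ θ, 0 < θ → θ < Real.pi →
      4 * t ≤ L ^ 2 / θ - Real.cot θ * (2 * ρ * Real.sin φ) ^ 2) :
    ρ * (φ + Real.sin φ * Real.cos φ) + t / ρ ≤ L := by
  have hpi := Real.pi_pos
  have hsφ := Real.sin_nonneg_of_nonneg_of_le_pi hφ (by linarith)
  have hL0 : 0 ≤ L := le_trans (by positivity) hL
  rcases hL0.eq_or_lt with h | h
  · have h1 : Real.sin φ = 0 := by
      have : 2 * ρ * Real.sin φ ≤ 0 := by linarith
      nlinarith
    have h2 : φ = 0 := by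
      by_contra h2
      have := Real.sin_pos_of_pos_of_lt_pi (lt_of_le_of_ne hφ (Ne.symm h2)) (by linarith)
      linarith
    have h3 := hdido (Real.pi / 2) (by positivity) (by linarith)
    rw [h1, ← h] at h3
    have : t ≤ 0 := by simp at h3; linarith
    rw [h2, ← h]
    simp
    exact div_nonpos_of_nonpos_of_nonneg this hρ.le
  obtain ⟨r, hr⟩ : ∃ r, L = 2 * ρ * r := ⟨L / (2 * ρ), by field_simp⟩
  have hr0 : 0 < r := by
    rw [hr] at h
    exact pos_of_mul_pos_right h (by positivity)
  -- a curve longer than the major arc of radius `ρ` is long enough to absorb the term `t / ρ`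
  have hmajor : Real.pi - φ ≤ r → ρ * (φ + Real.sin φ * Real.cos φ) + t / ρ ≤ L := by
    intro h1
    have h2 : t / ρ ≤ Real.pi * ρ / 2 := by
      rw [div_le_iff₀ hρ]; linarith
    have h3 : Real.sin φ * Real.cos φ ≤ Real.pi / 2 - φ := by
      have := Real.sin_le (x := Real.pi - 2 * φ) (by linarith)
      rw [Real.sin_pi_sub, Real.sin_two_mul] at this
      linarith
    have h4 : ρ * (φ + Real.sin φ * Real.cos φ) ≤ ρ * (Real.pi / 2) := by
      gcongr; linarith
    have h5 : ρ * (Real.pi / 2) ≤ ρ * r := by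
      gcongr; linarith
    rw [hr]
    linarith
  rcases le_or_gt (Real.pi - φ) r with h1 | h1
  · exact hmajor h1
  -- the angle of an arc of radius `ρ` and length `L` makes Dido's inequality linear in `L`
  · have h2 := hdido r hr0 (by linarith)
    have h3 := add_sin_mul_cos_le hφ hφ2 hr0 h1.le (by linarith)
    have h4 : t / ρ ≤ ρ * (r - Real.sin φ ^ 2 * Real.cot r) := by
      rw [div_le_iff₀ hρ]
      have e : L ^ 2 / r - Real.cot r * (2 * ρ * Real.sin φ) ^ 2 =
        4 * (ρ * (r - Real.sin φ ^ 2 * Real.cot r) * ρ) := by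
        rw [hr]; field_simp; ring
      linarith
    have h5 := mul_le_mul_of_nonneg_left h3 hρ.le
    rw [hr]
    linarith

theorem antitoneOn_div_sin_add_cos :
    AntitoneOn (fun t : ℝ => t / Real.sin t + Real.cos t) (Ioc 0 (Real.pi / 2)) := by
  have hs : ∀ t ∈ Ioc (0 : ℝ) (Real.pi / 2), 0 < Real.sin t := fun t ht =>
    Real.sin_pos_of_pos_of_lt_pi ht.1 (by linarith [ht.2, Real.pi_pos])
  have hd : ∀ t ∈ Ioc (0 : ℝ) (Real.pi / 2),
      HasDerivAt (fun t : ℝ => t / Real.sin t + Real.cos t)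
        (Real.cos t * (Real.sin t * Real.cos t - t) / Real.sin t ^ 2) t := by
    intro t ht
    have h := (hs t ht).ne'
    refine (((hasDerivAt_id t).div (Real.hasDerivAt_sin t) h).add
      (Real.hasDerivAt_cos t)).congr_deriv ?_
    have e2 : Real.cos t ^ 2 = 1 - Real.sin t ^ 2 := by linarith [Real.sin_sq_add_cos_sq t]
    simp only [id]
    field_simp
    grind
  apply antitoneOn_of_deriv_nonpos (convex_Ioc _ _)
  · exact fun t ht => (hd t ht).continuousAt.continuousWithinAt
  · rw [interior_Ioc]
    exact fun t ht => (hd t ⟨ht.1, ht.2.le⟩).differentiableAt.differentiableWithinAt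
  · rw [interior_Ioc]
    intro t ht
    rw [(hd t ⟨ht.1, ht.2.le⟩).deriv]
    have := segment_pos ht.1
    have hc := Real.cos_nonneg_of_mem_Icc (x := t) ⟨by linarith [ht.1, Real.pi_pos], ht.2.le⟩
    apply div_nonpos_of_nonpos_of_nonneg _ (sq_nonneg _)
    exact mul_nonpos_of_nonneg_of_nonpos hc (by linarith)

/-- With `g c = ρ (φ + sin φ cos φ)` for `c = 2 ρ sin φ`, the quotient `g c / c` is antitone. -/
theorem sin_mul_add_le {φ θ : ℝ} (hφ : 0 ≤ φ) (hφθ : φ ≤ θ) (hθ : θ ≤ Real.pi / 2) :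
    Real.sin φ * (θ + Real.sin θ * Real.cos θ) ≤ Real.sin θ * (φ + Real.sin φ * Real.cos φ) := by
  rcases hφ.eq_or_lt with rfl | h
  · simp
  have h1 := Real.sin_pos_of_pos_of_lt_pi h (by linarith)
  have h2 := Real.sin_pos_of_pos_of_lt_pi (h.trans_le hφθ) (by linarith)
  have h3 := antitoneOn_div_sin_add_cos ⟨h, hφθ.trans hθ⟩ ⟨h.trans_le hφθ, hθ⟩ hφθ
  have h4 := mul_le_mul_of_nonneg_left h3 (mul_nonneg h1.le h2.le)
  have e1 : Real.sin φ * Real.sin θ * (θ / Real.sin θ + Real.cos θ) =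
    Real.sin φ * (θ + Real.sin θ * Real.cos θ) := by field_simp
  have e2 : Real.sin φ * Real.sin θ * (φ / Real.sin φ + Real.cos φ) =
    Real.sin θ * (φ + Real.sin φ * Real.cos φ) := by field_simp
  simp only at h4
  linarith

/-- Edges with chords `c i ≤ s`, lengths `L i` and areas `z i` that satisfy Dido's inequality are
together at least as long as `ℓ / s` equal arcs of chord `s` that share the area `X`. If `ρ` is the
radius of these arcs, the dual bound for `ρ` holds with equality for them, and it is summed over the
edges. -/
theorem arc_le_of_dido {ι : Type*} (I : Finset ι) (c L z : ι → ℝ) {s ℓ X : ℝ}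
    (hc : ∀ i ∈ I, 0 ≤ c i) (hcs : ∀ i ∈ I, c i ≤ s) (hcL : ∀ i ∈ I, c i ≤ L i) (hs : 0 < s)
    (hsℓ : s < ℓ) (hℓ : ℓ ≤ ∑ i ∈ I, c i) (hX : 0 ≤ X) (hXs : X ≤ Real.pi * s ^ 2 / 8)
    (hXz : X ≤ ∑ i ∈ I, |z i|)
    (hdido : ∀ i ∈ I, ∀ θ, 0 < θ → θ < Real.pi →
      4 * |z i| ≤ L i ^ 2 / θ - Real.cot θ * c i ^ 2) :
    ℓ / s * arc s (s * X / ℓ) ≤ ∑ i ∈ I, L i := by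
  have hℓ0 : 0 < ℓ := hs.trans hsℓ
  have hcsum := Finset.sum_le_sum hcL
  rcases isArcLength_arc hs.le (show 0 ≤ s * X / ℓ by positivity) with
    ⟨-, h⟩ | ⟨ρ, θ, hρ, hθ, hθpi, hsρ, hXρ, h⟩
  -- the degenerate arc, which occurs for `X = 0`
  · rw [h, div_mul_cancel₀ _ hs.ne']
    linarith
  have hpi := Real.pi_pos
  have hp := segment_pos hθ
  have hXpos : 0 < X := by
    have : 0 < s * X / ℓ := by rw [hXρ]; positivity
    rcases hX.eq_or_lt with h' | h'
    · rw [← h'] at this; simp at this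
    · exact h'
  -- the area bound says that the comparison arc is at most a semicircle
  have hθ2 : θ ≤ Real.pi / 2 := by
    by_contra! hlt
    have h1 := segment_ratio_lt (half_pos hpi) hlt hθpi
    rw [Real.sin_pi_div_two, Real.cos_pi_div_two, div_lt_div_iff₀ hp (by linarith)] at h1
    have h2 : s * X / ℓ ≤ X := by
      rw [div_le_iff₀ hℓ0]; nlinarith
    have h3 : ρ ^ 2 * (θ - Real.sin θ * Real.cos θ) ≤ ρ ^ 2 * (Real.pi / 2 * Real.sin θ ^ 2) := by
      rw [← hXρ]
      calc _ ≤ X := h2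
        _ ≤ _ := hXs
        _ = _ := by rw [hsρ]; ring
    have h4 := le_of_mul_le_mul_left h3 (by positivity)
    linarith
  have hsin : 0 < Real.sin θ := Real.sin_pos_of_pos_of_lt_pi hθ (by linarith)
  set S := ∑ i ∈ I, |z i| with hS
  have hS0 : 0 < S := hXpos.trans_le hXz
  have hs2 : s ≤ 2 * ρ := by
    rw [hsρ]; nlinarith [Real.sin_le_one θ]
  -- each edge is charged with its share `|z i| * X / S ≤ X` of the total area
  have hedge : ∀ i ∈ I, c i / s * (ρ * (θ + Real.sin θ * Real.cos θ)) + |z i| * X / S / ρ ≤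
      L i := by
    intro i hi
    have hc0 := hc i hi
    have hci : c i ≤ 2 * ρ := (hcs i hi).trans hs2
    set φ := Real.arcsin (c i / (2 * ρ)) with hφ
    have hsφ : Real.sin φ = c i / (2 * ρ) := by
      apply Real.sin_arcsin
      · exact le_trans (by norm_num) (show 0 ≤ c i / (2 * ρ) by positivity)
      · rw [div_le_one (by positivity)]; exact hci
    have hcφ : c i = 2 * ρ * Real.sin φ := by rw [hsφ]; field_simp
    have hφ0 : 0 ≤ φ := Real.arcsin_nonneg.2 (by positivity)
    have hφ2 : φ ≤ Real.pi / 2 := Real.arcsin_le_pi_div_two _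
    have hφθ : φ ≤ θ := by
      rw [← Real.arcsin_sin (x := θ) (by linarith) hθ2]
      apply Real.monotone_arcsin
      rw [div_le_iff₀ (by positivity)]
      linarith [hcs i hi]
    have hzS : |z i| ≤ S := Finset.single_le_sum (fun j _ => abs_nonneg (z j)) hi
    have ht1 : |z i| * X / S ≤ |z i| := by
      rw [div_le_iff₀ hS0]; gcongr
    have ht2 : |z i| * X / S ≤ Real.pi * ρ ^ 2 / 2 := by
      calc |z i| * X / S ≤ X := by rw [div_le_iff₀ hS0, mul_comm X]; gcongr
        _ ≤ Real.pi * s ^ 2 / 8 := hXs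
        _ ≤ Real.pi * (2 * ρ) ^ 2 / 8 := by gcongr
        _ = _ := by ring
    have h1 := add_div_le_of_dido hρ hφ0 hφ2 ht2 (hcφ ▸ hcL i hi) (fun η h0 hη => by
      rw [← hcφ]; linarith [hdido i hi η h0 hη])
    have h2 := sin_mul_add_le hφ0 hφθ hθ2
    have h3 : c i / s * (ρ * (θ + Real.sin θ * Real.cos θ)) ≤
        ρ * (φ + Real.sin φ * Real.cos φ) := by
      rw [hcφ, hsρ]
      have e : 2 * ρ * Real.sin φ / (2 * ρ * Real.sin θ) *
          (ρ * (θ + Real.sin θ * Real.cos θ)) =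
          ρ * (Real.sin φ * (θ + Real.sin θ * Real.cos θ) / Real.sin θ) := by
        field_simp
      rw [e]
      gcongr
      rw [div_le_iff₀ hsin]; linarith
    linarith
  have hsum := Finset.sum_le_sum hedge
  rw [Finset.sum_add_distrib, ← Finset.sum_mul, ← Finset.sum_div, ← Finset.sum_div,
    ← Finset.sum_div, ← Finset.sum_mul, ← hS] at hsum
  have hG : 0 ≤ ρ * (θ + Real.sin θ * Real.cos θ) := by
    have := Real.cos_nonneg_of_mem_Icc (x := θ) ⟨by linarith, hθ2⟩
    positivity
  have h5 : ℓ / s * (ρ * (θ + Real.sin θ * Real.cos θ)) ≤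
      (∑ i ∈ I, c i) / s * (ρ * (θ + Real.sin θ * Real.cos θ)) := by gcongr
  have e : ℓ / s * arc s (s * X / ℓ) =
      ℓ / s * (ρ * (θ + Real.sin θ * Real.cos θ)) + S * X / S / ρ := by
    have hX' : X = ℓ / s * (ρ ^ 2 * (θ - Real.sin θ * Real.cos θ)) := by
      rw [← hXρ]; field_simp
    rw [h, mul_div_cancel_left₀ _ hS0.ne', hX']
    field_simp
    ring
  linarith

/-! ### Line integrals along rectifiable curves -/

namespace MarkedCurve

variable {N : ℕ} (P : MarkedCurve N)

theorem yExt_eq {t : ℝ} (ht : t ∈ Icc (P.τ 0) (P.τ (Fin.last N))) : P.yExt t = P.γ t 1 := by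
  rw [yExt, projIcc_of_mem _ ht]

theorem continuous_yExt : Continuous P.yExt := by
  have h : Continuous fun t =>
      P.γ (projIcc (P.τ 0) (P.τ (Fin.last N)) (P.mono (Fin.zero_le _)) t) :=
    P.continuousOn.comp_continuous (continuous_subtype_val.comp continuous_projIcc)
      fun t => (projIcc _ _ _ t).2
  unfold yExt
  fun_prop

theorem vectorMeasure_yExt_Ioc {a b : ℝ} (hab : a ≤ b) :
    P.boundedVariationOn_yExt.vectorMeasure (Ioc a b) = P.yExt b - P.yExt a := by
  rw [BoundedVariationOn.vectorMeasure_Ioc _ hab,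
    P.continuous_yExt.continuousAt.continuousWithinAt.rightLim_eq,
    P.continuous_yExt.continuousAt.continuousWithinAt.rightLim_eq]

instance : IsFiniteMeasure P.boundedVariationOn_yExt.vectorMeasure.variation := by
  rw [← SignedMeasure.totalVariation_eq_variation]
  infer_instance

theorem integrableOn_lineIntegral {a b : ℝ} (ha : P.τ 0 ≤ a) (hb : b ≤ P.τ (Fin.last N)) :
    P.boundedVariationOn_yExt.vectorMeasure.IntegrableOn (fun t => P.γ t 0) (Ioc a b) := by
  unfold VectorMeasure.IntegrableOn VectorMeasure.Integrable
  rw [VectorMeasure.variation_restrict measurableSet_Ioc]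
  have h : ContinuousOn (fun t => P.γ t 0) (Icc a b) := by
    have := P.continuousOn.mono (Icc_subset_Icc ha hb)
    fun_prop
  exact (h.integrableOn_compact isCompact_Icc).mono_set Ioc_subset_Icc_self

theorem lineIntegral_add {a b c : ℝ} (ha : P.τ 0 ≤ a) (hab : a ≤ b) (hbc : b ≤ c)
    (hc : c ≤ P.τ (Fin.last N)) :
    P.lineIntegral a b + P.lineIntegral b c = P.lineIntegral a c := by
  unfold lineIntegral
  rw [← Ioc_union_Ioc_eq_Ioc hab hbc, VectorMeasure.setIntegral_union
    (Ioc_disjoint_Ioc_of_le le_rfl) measurableSet_Ioc measurableSet_Ioc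
    (P.integrableOn_lineIntegral ha (hbc.trans hc))
    (P.integrableOn_lineIntegral (ha.trans hab) hc)]

theorem lineIntegral_self (a : ℝ) : P.lineIntegral a a = 0 := by
  simp [lineIntegral]

theorem sum_lineIntegral (u : ℕ → ℝ) (hu : Monotone u) (n : ℕ) (h0 : P.τ 0 ≤ u 0)
    (hn : u n ≤ P.τ (Fin.last N)) :
    ∑ j ∈ Finset.range n, P.lineIntegral (u j) (u (j + 1)) = P.lineIntegral (u 0) (u n) := by
  induction n with
  | zero => simp [lineIntegral_self]
  | succ n ih =>
    rw [Finset.sum_range_succ, ih ((hu n.le_succ).trans hn),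
      P.lineIntegral_add h0 (hu (Nat.zero_le n)) (hu n.le_succ) hn]

/-- The error of one trapezoid is the oscillation of `x` times the variation of the measure `dy`. -/
theorem abs_lineIntegral_sub_le {a b ε : ℝ} (ha : P.τ 0 ≤ a) (hab : a ≤ b)
    (hb : b ≤ P.τ (Fin.last N))
    (hε : ∀ t ∈ Icc a b, ∀ t' ∈ Icc a b, |P.γ t 0 - P.γ t' 0| ≤ ε) :
    |P.lineIntegral a b - (P.γ a 0 + P.γ b 0) / 2 * (P.γ b 1 - P.γ a 1)| ≤
      ε * P.boundedVariationOn_yExt.vectorMeasure.variation.real (Ioc a b) := by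
  set μ := P.boundedVariationOn_yExt.vectorMeasure with hμ
  have h1 : (P.γ a 0 + P.γ b 0) / 2 * (P.γ b 1 - P.γ a 1) =
      VectorMeasure.integral (μ.restrict (Ioc a b)) (fun _ => (P.γ a 0 + P.γ b 0) / 2)
        (ContinuousLinearMap.lsmul ℝ ℝ) := by
    rw [VectorMeasure.setIntegral_const, hμ, P.vectorMeasure_yExt_Ioc hab,
      P.yExt_eq ⟨ha, hab.trans hb⟩, P.yExt_eq ⟨ha.trans hab, hb⟩]
    simp
  rw [h1, lineIntegral, ← hμ, ← VectorMeasure.integral_fun_sub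
    (P.integrableOn_lineIntegral ha hb) (integrable_const _), ← Real.norm_eq_abs]
  refine (VectorMeasure.norm_setIntegral_le_of_norm_le_const (C := ε) ?_).trans ?_
  · intro t ht
    have h2 := hε t (Ioc_subset_Icc_self ht) a (left_mem_Icc.2 hab)
    have h3 := hε t (Ioc_subset_Icc_self ht) b (right_mem_Icc.2 hab)
    rw [Real.norm_eq_abs]
    rw [abs_le] at h2 h3 ⊢
    constructor <;> linarith
  · have hε0 : 0 ≤ ε := (abs_nonneg _).trans
      (hε a (left_mem_Icc.2 hab) a (left_mem_Icc.2 hab))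
    have : ‖(ContinuousLinearMap.lsmul ℝ ℝ : ℝ →L[ℝ] ℝ →L[ℝ] ℝ)‖ ≤ 1 :=
      ContinuousLinearMap.opNorm_lsmul_le
    apply mul_le_mul_of_nonneg_right _ measureReal_nonneg
    nlinarith

theorem exists_trapezoid_near {a b ε : ℝ} (ha : P.τ 0 ≤ a) (hab : a ≤ b)
    (hb : b ≤ P.τ (Fin.last N)) (hε : 0 < ε) :
    ∃ (n : ℕ) (u : ℕ → ℝ), Monotone u ∧ u 0 = a ∧ u n = b ∧ (∀ j, u j ∈ Icc a b) ∧
      |P.lineIntegral a b - ∑ j ∈ Finset.range n,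
        (P.γ (u j) 0 + P.γ (u (j + 1)) 0) / 2 * (P.γ (u (j + 1)) 1 - P.γ (u j) 1)| ≤ ε := by
  set μ := P.boundedVariationOn_yExt.vectorMeasure with hμ
  set V := μ.variation.real univ with hV
  have hV0 : 0 ≤ V := measureReal_nonneg
  have hcont : ContinuousOn (fun t => P.γ t 0) (Icc a b) := by
    have := P.continuousOn.mono (Icc_subset_Icc ha hb)
    fun_prop
  have hunif := isCompact_Icc.uniformContinuousOn_of_continuous hcont
  rw [Metric.uniformContinuousOn_iff_le] at hunif
  obtain ⟨δ, hδ, hδε⟩ := hunif (ε / (V + 1)) (by positivity)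
  obtain ⟨m, hm⟩ := exists_nat_gt ((b - a) / δ)
  have hm' : b ≤ a + m * δ := by
    rw [div_lt_iff₀ hδ] at hm; linarith
  have hu : Monotone fun j : ℕ => min (a + j * δ) b := by
    intro i j hij
    dsimp only
    gcongr
  have hu0 : min (a + (0 : ℕ) * δ) b = a := by simpa using hab
  have hum : min (a + (m : ℕ) * δ) b = b := min_eq_right hm'
  have humem : ∀ j : ℕ, min (a + j * δ) b ∈ Icc a b := fun j =>
    ⟨le_min (by have : 0 ≤ j * δ := by positivity
                linarith) hab, min_le_right _ _⟩
  refine ⟨m, fun j => min (a + j * δ) b, hu, hu0, hum, humem, ?_⟩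
  have hsum := P.sum_lineIntegral (fun j : ℕ => min (a + j * δ) b) hu m (by rw [hu0]; exact ha)
    (by rw [hum]; exact hb)
  rw [hu0, hum] at hsum
  rw [← hsum, ← Finset.sum_sub_distrib]
  refine (Finset.abs_sum_le_sum_abs _ _).trans ?_
  have hterm : ∀ j ∈ Finset.range m, _ ≤ ε / (V + 1) * μ.variation.real
      (Ioc (min (a + j * δ) b) (min (a + (j + 1 : ℕ) * δ) b)) := fun j _ =>
    P.abs_lineIntegral_sub_le (ha.trans (humem j).1) (hu j.le_succ) ((humem _).2.trans hb)
      (by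
        intro t ht t' ht'
        have hsub : Icc (min (a + j * δ) b) (min (a + (j + 1 : ℕ) * δ) b) ⊆ Icc a b :=
          Icc_subset_Icc (humem _).1 (humem _).2
        refine hδε t (hsub ht) t' (hsub ht') ?_
        have hlen : min (a + (j + 1 : ℕ) * δ) b - min (a + j * δ) b ≤ δ := by
          push_cast
          rcases min_cases (a + j * δ) b with h | h <;>
            rcases min_cases (a + (j + 1) * δ) b with h' | h' <;> linarith
        rw [Real.dist_eq, abs_le]
        constructor <;> linarith [ht.1, ht.2, ht'.1, ht'.2])
  refine (Finset.sum_le_sum hterm).trans ?_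
  rw [← Finset.mul_sum]
  have hmeas : ∑ j ∈ Finset.range m, μ.variation.real
      (Ioc (min (a + j * δ) b) (min (a + (j + 1 : ℕ) * δ) b)) ≤ V := by
    rw [← measureReal_biUnion_finset]
    · exact measureReal_mono (subset_univ _)
    · intro i _ j _ hij
      exact hu.pairwise_disjoint_on_Ioc_succ hij
    · exact fun _ _ => measurableSet_Ioc
  calc _ ≤ ε / (V + 1) * V := by gcongr
    _ ≤ ε := by
      rw [div_mul_eq_mul_div, div_le_iff₀ (by positivity)]
      nlinarith

theorem dist_sq_eq (v w : EuclideanSpace ℝ (Fin 2)) :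
    dist v w ^ 2 = (w 0 - v 0) ^ 2 + (w 1 - v 1) ^ 2 := by
  rw [EuclideanSpace.dist_eq, Real.sq_sqrt (by positivity), Fin.sum_univ_two, Real.dist_eq,
    Real.dist_eq, sq_abs, sq_abs]
  ring

/-- Dido's inequality for a part of a rectifiable curve, from that for inscribed polygons. -/
theorem four_mul_abs_lineIntegral_sub_chord_le {a b θ : ℝ} (ha : P.τ 0 ≤ a) (hab : a ≤ b)
    (hb : b ≤ P.τ (Fin.last N)) (hθ : 0 < θ) (hpi : θ < Real.pi) :
    4 * |P.lineIntegral a b - (P.γ a 0 + P.γ b 0) / 2 * (P.γ b 1 - P.γ a 1)| ≤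
      (eVariationOn P.γ (Icc a b)).toReal ^ 2 / θ -
        Real.cot θ * dist (P.γ a) (P.γ b) ^ 2 := by
  have hbv : eVariationOn P.γ (Icc a b) ≠ ⊤ := P.rectifiable.mono (Icc_subset_Icc ha hb)
  apply le_of_forall_pos_le_add
  intro ε hε
  obtain ⟨n, u, hu, hu0, hun, humem, hI⟩ :=
    P.exists_trapezoid_near ha hab hb (ε := ε / 4) (by positivity)
  have hd := abs_four_mul_trapezoid_sub_chord_le (fun j => P.γ (u j) 0) (fun j => P.γ (u j) 1)
    (fun j => dist (P.γ (u j)) (P.γ (u (j + 1)))) n hθ hpi (fun _ => dist_nonneg)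
    (fun j => dist_sq_eq _ _)
  have hlen : ∑ j ∈ Finset.range n, dist (P.γ (u j)) (P.γ (u (j + 1))) ≤
      (eVariationOn P.γ (Icc a b)).toReal := by
    have := eVariationOn.sum_le (f := P.γ) (n := n) hu humem
    have h2 := ENNReal.toReal_mono hbv this
    rw [ENNReal.toReal_sum (fun j _ => edist_ne_top _ _)] at h2
    simpa only [edist_dist, ENNReal.toReal_ofReal dist_nonneg, dist_comm] using h2
  have hsq : (∑ j ∈ Finset.range n, dist (P.γ (u j)) (P.γ (u (j + 1)))) ^ 2 / θ ≤
      (eVariationOn P.γ (Icc a b)).toReal ^ 2 / θ := by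
    have : 0 ≤ ∑ j ∈ Finset.range n, dist (P.γ (u j)) (P.γ (u (j + 1))) :=
      Finset.sum_nonneg fun _ _ => dist_nonneg
    gcongr
  simp only [hu0, hun] at hd
  rw [← dist_sq_eq] at hd
  have htri := abs_sub_le (P.lineIntegral a b)
    (∑ j ∈ Finset.range n,
        (P.γ (u j) 0 + P.γ (u (j + 1)) 0) / 2 * (P.γ (u (j + 1)) 1 - P.γ (u j) 1))
    ((P.γ a 0 + P.γ b 0) / 2 * (P.γ b 1 - P.γ a 1))
  linarith

end MarkedCurve

/-! ### Chords and edges of a marked curve -/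

namespace MarkedCurve

variable {N : ℕ} (P : MarkedCurve N)

/-- The parameter of the `j`-th marked point, as a sequence on `ℕ` that is constant from the
return to the initial point on. -/
def param (j : ℕ) : ℝ := P.τ ⟨min j N, by omega⟩

theorem monotone_param : Monotone P.param := fun i j hij =>
  P.mono (by simp only [Fin.mk_le_mk]; omega)

theorem param_zero : P.param 0 = P.τ 0 := by simp [param]

theorem param_last : P.param N = P.τ (Fin.last N) := by
  simp only [param, min_self]; rfl

theorem param_castSucc (i : Fin N) : P.param i = P.τ i.castSucc :=
  congrArg P.τ (Fin.ext (min_eq_left i.2.le))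

theorem param_succ (i : Fin N) : P.param (i + 1) = P.τ i.succ :=
  congrArg P.τ (Fin.ext (min_eq_left (Nat.succ_le_of_lt i.2)))

theorem src_eq (i : Fin N) : P.src i = P.γ (P.param i) := by rw [src, param_castSucc]

theorem tgt_eq (i : Fin N) : P.tgt i = P.γ (P.param (i + 1)) := by rw [tgt, param_succ]

/-- The length of the `i`-th edge. -/
noncomputable def edgeLength (i : Fin N) : ℝ :=
  (eVariationOn P.γ (Icc (P.τ i.castSucc) (P.τ i.succ))).toReal

theorem Icc_edge_subset (i : Fin N) :
    Icc (P.τ i.castSucc) (P.τ i.succ) ⊆ Icc (P.τ 0) (P.τ (Fin.last N)) :=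
  Icc_subset_Icc (P.mono (Fin.zero_le _)) (P.mono (Fin.le_last _))

theorem sum_edgeLength : ∑ i, P.edgeLength i = P.length := by
  have h := eVariationOn.sum' P.γ P.monotone_param (n := N)
  rw [param_zero, param_last, Finset.sum_range] at h
  rw [length, ← h, ENNReal.toReal_sum]
  · simp only [edgeLength, param_castSucc, param_succ]
  · intro i _
    rw [param_castSucc, param_succ]
    exact P.rectifiable.mono (P.Icc_edge_subset i)

theorem sum_lineIntegral_edge :
    ∑ i : Fin N, P.lineIntegral (P.τ i.castSucc) (P.τ i.succ) = P.area := by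
  have h := P.sum_lineIntegral P.param P.monotone_param N P.param_zero.ge P.param_last.le
  rw [param_zero, param_last, Finset.sum_range] at h
  rw [area, ← h]
  simp only [param_castSucc, param_succ]

theorem chordLength_le_edgeLength (i : Fin N) : P.chordLength i ≤ P.edgeLength i := by
  have hle : P.τ i.castSucc ≤ P.τ i.succ := P.mono (Fin.castSucc_lt_succ).le
  have h := ENNReal.toReal_mono (P.rectifiable.mono (P.Icc_edge_subset i))
    (eVariationOn.edist_le P.γ (left_mem_Icc.2 hle) (right_mem_Icc.2 hle))
  rwa [edist_dist, ENNReal.toReal_ofReal dist_nonneg] at h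

/-- The hypotheses exclude `s = 0`, for which all chords would vanish. -/
theorem chordal_isoperimetric {s ℓ : ℝ} (hs : ∀ i, P.chordLength i ≤ s) (hsℓ : s < ℓ)
    (hℓ : ℓ ≤ ∑ i, P.chordLength i) (hX : |P.X| ≤ Real.pi * s ^ 2 / 8) :
    ℓ / s * arc s (s * |P.X| / ℓ) ≤ P.length := by
  have hN := P.two_le
  have hs0 : 0 ≤ s := dist_nonneg.trans (hs ⟨0, by omega⟩)
  have hspos : 0 < s := by
    refine lt_of_le_of_ne hs0 fun h => ?_
    have := hℓ.trans (Finset.sum_le_sum fun i _ => hs i)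
    rw [← h] at this hsℓ
    simp at this
    linarith
  rw [← P.sum_edgeLength]
  refine arc_le_of_dido Finset.univ P.chordLength P.edgeLength P.edgeArea
    (fun _ _ => dist_nonneg) (fun i _ => hs i) (fun i _ => P.chordLength_le_edgeLength i)
    hspos hsℓ hℓ (abs_nonneg _) hX (Finset.abs_sum_le_sum_abs _ _) ?_
  intro i _ θ h0 hpi
  exact P.four_mul_abs_lineIntegral_sub_chord_le (P.mono (Fin.zero_le _))
    (P.mono (Fin.castSucc_lt_succ).le) (P.mono (Fin.le_last _)) h0 hpi

/-- The polygon of chords has signed area `area P - X P`. -/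
theorem four_mul_area_sub_X_le :
    4 * (P.area - P.X) ≤ (∑ i, P.chordLength i) ^ 2 * (Real.cot (Real.pi / N) / N) := by
  have hclosed : P.γ (P.param N) = P.γ (P.param 0) := by
    rw [param_last, param_zero, P.closed]
  have hsum : ∑ i, P.chordLength i =
      ∑ j ∈ Finset.range N, dist (P.γ (P.param j)) (P.γ (P.param (j + 1))) := by
    rw [Finset.sum_range]
    simp only [chordLength, src_eq, tgt_eq]
  have h := trapezoid_le_of_closed (fun j => P.γ (P.param j) 0) (fun j => P.γ (P.param j) 1)
    (fun j => dist (P.γ (P.param j)) (P.γ (P.param (j + 1)))) N (fun _ => dist_nonneg)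
    (fun j => dist_sq_eq _ _) ?_ (by simp only [hclosed]) (by simp only [hclosed])
  · rw [← hsum] at h
    have harea : P.area - P.X = ∑ j ∈ Finset.range N,
        (P.γ (P.param j) 0 + P.γ (P.param (j + 1)) 0) / 2 *
          (P.γ (P.param (j + 1)) 1 - P.γ (P.param j) 1) := by
      rw [Finset.sum_range, ← P.sum_lineIntegral_edge, X, ← Finset.sum_sub_distrib]
      simp only [edgeArea, src_eq, tgt_eq, sub_sub_cancel]
    rw [harea]
    exact h
  · -- the two paths between the ends of the `j`-th chord along the closed polygon
    intro j hj
    have h1 := dist_le_range_sum_dist (fun j => P.γ (P.param j)) j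
    have h2 := dist_le_Ico_sum_dist (fun j => P.γ (P.param j)) (Nat.succ_le_of_lt hj)
    have h3 := Finset.sum_range_add_sum_Ico
      (fun j => dist (P.γ (P.param j)) (P.γ (P.param (j + 1)))) (Nat.succ_le_of_lt hj)
    rw [Finset.sum_range_succ] at h3
    rw [hclosed] at h2
    have h4 := dist_triangle_left (P.γ (P.param j)) (P.γ (P.param (j + 1))) (P.γ (P.param 0))
    rw [dist_comm (P.γ (P.param 0)) (P.γ (P.param (j + 1)))] at h4
    linarith

theorem three_le_and_polygonBound_le {α : ℝ} (hα : α ≤ P.area) (hX : P.X < α) :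
    3 ≤ N ∧ polygonBound N α P.X ≤ ∑ i, P.chordLength i := by
  have hN := P.two_le
  have h := P.four_mul_area_sub_X_le
  have hN3 : 3 ≤ N := by
    by_contra! hlt
    obtain rfl : N = 2 := by omega
    rw [Real.cot_eq_cos_div_sin, Nat.cast_ofNat, Real.cos_pi_div_two] at h
    simp at h
    linarith
  have hN' : (3 : ℝ) ≤ N := by exact_mod_cast hN3
  have htan : 0 < Real.tan (Real.pi / N) := by
    apply Real.tan_pos_of_pos_of_lt_pi_div_two (by positivity)
    exact div_lt_div_of_pos_left Real.pi_pos two_pos (by linarith)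
  refine ⟨hN3, ?_⟩
  have hS : 0 ≤ ∑ i, P.chordLength i := Finset.sum_nonneg fun _ _ => dist_nonneg
  have hcot : Real.cot (Real.pi / N) / N = 1 / piN N := by
    rw [piN, ← Real.tan_inv_eq_cot]
    field_simp
  have hpos : 0 < piN N := mul_pos (by linarith) htan
  rw [hcot, mul_one_div, le_div_iff₀ hpos] at h
  rw [polygonBound, ← le_div_iff₀' two_pos, Real.sqrt_le_left (by positivity)]
  nlinarith

end MarkedCurve

theorem pi_le_piN {N : ℕ} (hN : 3 ≤ N) : Real.pi ≤ piN N := by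
  have hN' : (3 : ℝ) ≤ N := by exact_mod_cast hN
  have h := Real.le_tan (x := Real.pi / N) (by positivity)
    (div_lt_div_of_pos_left Real.pi_pos two_pos (by linarith))
  rw [div_le_iff₀ (by linarith), mul_comm] at h
  exact h

theorem proposition6p1 {N : ℕ} (P : MarkedCurve N) :
    (∀ s ℓ : ℝ, (∀ i, P.chordLength i ≤ s) → s < ℓ → ℓ ≤ ∑ i, P.chordLength i →
      |P.X| ≤ Real.pi * s ^ 2 / 8 →
      ℓ / s * arc s (s * |P.X| / ℓ) ≤ P.length) ∧
    ((∀ i, P.chordLength i ≤ 1) → |P.X| ≤ 0.119 → 0.996 ≤ P.alpha → P.alpha ≤ 1 → N ≤ 7 →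
      arcBound N P.alpha P.X ≤ P.length) := by
  refine ⟨fun s ℓ hs hsℓ hℓ hX => P.chordal_isoperimetric hs hsℓ hℓ hX,
    fun hchord hX hα _ _ => ?_⟩
  have hX' := (abs_le.1 hX).2
  obtain ⟨hN, hle⟩ := P.three_le_and_polygonBound_le (α := P.alpha) (min_le_right _ _)
    (by linarith)
  have hpiN := pi_le_piN hN
  have hpi := Real.pi_gt_three
  have hgt : 1 < polygonBound N P.alpha P.X := by
    have : 1 ≤ Real.sqrt ((P.alpha - P.X) * piN N) := by
      rw [Real.one_le_sqrt]
      nlinarith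
    rw [polygonBound]
    linarith
  have h := P.chordal_isoperimetric hchord hgt hle (by linarith)
  rwa [div_one, one_mul] at h
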